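/- Let $a,b,c,d\in\mathbb{R}$ with $ac\neq 0$ and $(a,\,b+c,\,d)\neq(1,0,0)$. Define polynomials by $W_0(z)=1$, $W_1(z)=z$ and $W_n(z)=A(z)W_{n-1}(z)+B(z)W_{n-2}(z)$ for $n\ge 2$, where $A(z)=az+b$ and $B(z)=cz+d$. With $\sqrt{\cdot}$ the principal square root ($\sqrt{re^{i\theta}}=\sqrt r\,e^{i\theta/2}$ for $\theta\in(-\pi,\pi]$), put $$\Delta(z)=A(z)^2+4B(z),\quad h(z)=(2-a)z-b,\quad g(z)=(1-a)z^2-(b+c)z-d,$$ $$\lambda_\pm(z)=\frac{A(z)\pm\sqrt{\Delta(z)}}2,\qquad \alpha_\pm(z)=\frac{\sqrt{\Delta(z)}\pm h(z)}{2\sqrt{\Delta(z)}}\ \ (\Delta(z)\ne0).$$ A number $z^*\in\mathbb{C}$ is a limit of zeros if for each $n\ge1$ there is a zero $z_n$ of $W_n$ such that $z_n\to z^*$. A limit of zeros $z$ is called non-isolated if $|\lambda_+(z)|=|\lambda_-(z)|$, and isolated if either $\alpha_-(z)=0$ and $|\lambda_+(z)|<|\lambda_-(z)|$, or $\alpha_+(z)=0$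 and $|\lambda_+(z)|>|\lambda_-(z)|$. Let $$x_A=-\frac ba,\quad x_B=-\frac dc,\quad \Delta_\Delta=c^2-a^2B(x_A),\quad x_\Delta^\pm=x_A+\frac{-2c\pm2\sqrt{\Delta_\Delta}}{a^2},$$ let $C_0=\{z\in\mathbb{C}:|z-x_B|=|x_A-x_B|\}$ and, when $\Delta_\Delta\ge0$, let $J_\Delta=\{x\in\mathbb{R}:x_\Delta^-\le x\le x_\Delta^+\}$. Then every limit of zeros is isolated or non-isolated. The set of isolated limits of zeros is $$\{z\in\mathbb{C}: g(z)=0,\ \operatorname{Re}(A(z)\overline{h(z)})<0\},$$ and the set of non-isolated limits of zeros is - the circular arc connecting $x_\Delta^-$ and $x_\Delta^+$ through $x_A$ (endpoints included), if $\Delta_\Delta<0$; - $C_0$, if $\Delta_\Delta=0$; - $J_\Delta\cup C_0$, if $\Delta_\Delta>0$ and $B(x_A)>0$; - $J_\Delta$, if $\Delta_\Delta>0$ and $B(x_A)\le0$. -/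

import Mathlib

open Filter Topology Polynomial

namespace LinRec

/-- The polynomials `W 0 = 1`, `W 1 = z`, `W n = (a z + b) W (n-1) + (c z + d) W (n-2)`. -/
noncomputable def W (a b c d : ℝ) : ℕ → ℂ[X]
  | 0 => 1
  | 1 => X
  | n + 2 => (C (a : ℂ) * X + C (b : ℂ)) * W a b c d (n + 1)
      + (C (c : ℂ) * X + C (d : ℂ)) * W a b c d n

/-- `w` is a limit of zeros of the sequence `W n`: for each `n ≥ 1` there is a zero of `W n`
such that the chosen zeros converge to `w` (the constant polynomial `W 0 = 1` has no zero). -/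
def IsLimitOfZeros (a b c d : ℝ) (w : ℂ) : Prop :=
  ∃ z : ℕ → ℂ, (∀ n, 1 ≤ n → (W a b c d n).IsRoot (z n)) ∧ Tendsto z atTop (𝓝 w)

/-- `A(z) = a z + b`. -/
def A (a b : ℝ) (z : ℂ) : ℂ := a * z + b

/-- `B(z) = c z + d`. -/
def B (c d : ℝ) (z : ℂ) : ℂ := c * z + d

/-- `Δ(z) = A(z)² + 4 B(z)`. -/
def Delta (a b c d : ℝ) (z : ℂ) : ℂ := A a b z ^ 2 + 4 * B c d z

/-- `h(z) = 2 W₁(z) - A(z) = (2 - a) z - b`. -/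
def h (a b : ℝ) (z : ℂ) : ℂ := (2 - a) * z - b

/-- `g(z) = (1 - a) z² - (b + c) z - d`. -/
def g (a b c d : ℝ) (z : ℂ) : ℂ := (1 - a) * z ^ 2 - (b + c) * z - d

/-- `λ₊(z) = (A(z) + √Δ(z)) / 2`, with the principal square root. -/
noncomputable def lamPlus (a b c d : ℝ) (z : ℂ) : ℂ := (A a b z + Complex.sqrt (Delta a b c d z)) / 2

/-- `λ₋(z) = (A(z) - √Δ(z)) / 2`. -/
noncomputable def lamMinus (a b c d : ℝ) (z : ℂ) : ℂ := (A a b z - Complex.sqrt (Delta a b c d z)) / 2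

/-- `α₊(z) = (√Δ(z) + h(z)) / (2 √Δ(z))`, meaningful where `Δ(z) ≠ 0`. -/
noncomputable def alphaPlus (a b c d : ℝ) (z : ℂ) : ℂ :=
  (Complex.sqrt (Delta a b c d z) + h a b z) / (2 * Complex.sqrt (Delta a b c d z))

/-- `α₋(z) = (√Δ(z) - h(z)) / (2 √Δ(z))`, meaningful where `Δ(z) ≠ 0`. -/
noncomputable def alphaMinus (a b c d : ℝ) (z : ℂ) : ℂ :=
  (Complex.sqrt (Delta a b c d z) - h a b z) / (2 * Complex.sqrt (Delta a b c d z))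

/-- The isolated limits of zeros: the limits of zeros at which the coefficient of the
strictly dominant characteristic root vanishes. (The strict inequalities force `Δ(z) ≠ 0`, so the
value of `α₊`, `α₋` at zeros of `Δ` is irrelevant.) -/
def isolatedLimits (a b c d : ℝ) : Set ℂ :=
  {z | IsLimitOfZeros a b c d z ∧
    ((alphaMinus a b c d z = 0 ∧ ‖lamPlus a b c d z‖ < ‖lamMinus a b c d z‖) ∨
     (alphaPlus a b c d z = 0 ∧ ‖lamMinus a b c d z‖ < ‖lamPlus a b c d z‖))}

/-- The non-isolated limits of zeros: the limits of zeros at which the two characteristic roots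
have the same modulus. -/
def nonIsolatedLimits (a b c d : ℝ) : Set ℂ :=
  {z | IsLimitOfZeros a b c d z ∧ ‖lamPlus a b c d z‖ = ‖lamMinus a b c d z‖}

/-- `x_A = -b / a`, the zero of `A`. -/
noncomputable def xA (a b : ℝ) : ℝ := -b / a

/-- `x_B = -d / c`, the zero of `B`. -/
noncomputable def xB (c d : ℝ) : ℝ := -d / c

/-- The real number `B(x_A)`. -/
noncomputable def BxA (a b c d : ℝ) : ℝ := c * xA a b + d

/-- `Δ_Δ = c² - a² B(x_A)`. -/
noncomputable def DeltaDelta (a b c d : ℝ) : ℝ := c ^ 2 - a ^ 2 * BxA a b c d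

/-- `x_Δ⁺ = x_A + (-2 c + 2 √Δ_Δ) / a²`. -/
noncomputable def xDeltaPlus (a b c d : ℝ) : ℂ :=
  xA a b + (-2 * c + 2 * Complex.sqrt (DeltaDelta a b c d)) / a ^ 2

/-- `x_Δ⁻ = x_A + (-2 c - 2 √Δ_Δ) / a²`. -/
noncomputable def xDeltaMinus (a b c d : ℝ) : ℂ :=
  xA a b + (-2 * c - 2 * Complex.sqrt (DeltaDelta a b c d)) / a ^ 2

/-- The closed circular arc connecting `p` and `r` through `q`, for `p`, `q`, `r` not collinear:
the points of the circle through `p`, `q`, `r` that do not lie strictly on the other side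
of the line `pr` than `q`. -/
def circularArc (p q r : ℂ) : Set ℂ :=
  {z | EuclideanGeometry.Cospherical ({p, q, r, z} : Set ℂ) ∧
    (affineSpan ℝ ({p, r} : Set ℂ)).WSameSide q z}

/-- The circle `C₀` with centre `x_B` and radius `|x_A - x_B|`. -/
noncomputable def C0 (a b c d : ℝ) : Set ℂ :=
  {z | ‖z - (xB c d : ℂ)‖ = |xA a b - xB c d|}

/-- The real interval `J_Δ = [x_Δ⁻, x_Δ⁺]`, as a subset of the complex plane, for `Δ_Δ ≥ 0`
(when `x_Δ⁻` and `x_Δ⁺` are real). -/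
noncomputable def JDelta (a b c d : ℝ) : Set ℂ :=
  {z | ∃ x : ℝ, z = x ∧ (xDeltaMinus a b c d).re ≤ x ∧ x ≤ (xDeltaPlus a b c d).re}

end LinRec

/-!
If `s² = Δ(z)`, then `2 ^ (n + 1) * s * W n z = (s + h) (A + s) ^ n + (s - h) (A - s) ^ n`, with
`(s + h) (s - h) = -4 g`. Where one of the two bases strictly dominates, zeros can accumulate only
if its coefficient vanishes, and by Hurwitz's theorem they do so there; where the moduli agree,
zeros accumulate because the equation says that an `n`-th power takes a prescribed value. This is
the Beraha–Kahane–Weiss argument; it fails at the zeros of `Δ` and, for equal moduli, of `g`, but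
the limits of zeros form a closed set and the locus `|λ₊| = |λ₋|` has no isolated points.

The moduli of `A + s` and `A - s` agree iff `0` lies on the segment from `A²` to `Δ = A² + 4 B`,
that is, iff `A² + 4 θ B = 0` for some `θ ∈ [0, 1]`. Separating real and imaginary parts of this
equation about `x_A` gives either a point of the real axis or a point of `C₀`.
-/

namespace LinRec

open scoped Real

/-! ### Zeros of `α * u ^ n + β * v ^ n` -/

/-- A form of **Hurwitz's theorem**, by the maximum principle for `1 / f i` on a small disc. -/
theorem eventually_exists_mem_eq_zero_of_tendstoUniformlyOn {ι : Type*} {l : Filter ι}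
    {f : ι → ℂ → ℂ} {F : ℂ → ℂ} {w : ℂ} {U V : Set ℂ} (hU : U ∈ 𝓝 w) (hV : V ∈ 𝓝 w)
    (hf : ∀ i, DifferentiableOn ℂ (f i) U) (hlim : TendstoUniformlyOn f F l U)
    (hF : AnalyticAt ℂ F w) (hFw : F w = 0) (hne : ¬ ∀ᶠ z in 𝓝 w, F z = 0) :
    ∀ᶠ i in l, ∃ z ∈ V, f i z = 0 := by
  have hF₀ : ∀ᶠ z in 𝓝 w, z ≠ w → F z ≠ 0 :=
    eventually_nhdsWithin_iff.1 (hF.eventually_eq_zero_or_eventually_ne_zero.resolve_left hne)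
  obtain ⟨r, hr, hball⟩ := Metric.nhds_basis_closedBall.mem_iff.1
    (inter_mem (inter_mem hU hV) (hF.eventually_analyticAt.and hF₀))
  have hsphere := Metric.sphere_subset_closedBall.trans hball
  obtain ⟨x, hx, hmin⟩ := (isCompact_sphere w r).exists_isMinOn
    (NormedSpace.sphere_nonempty.2 hr.le) (f := fun z ↦ ‖F z‖)
    fun z hz ↦ (hsphere hz).2.1.continuousAt.norm.continuousWithinAt
  have hm : 0 < ‖F x‖ :=
    norm_pos_iff.2 ((hsphere hx).2.2 (Metric.ne_of_mem_sphere hx hr.ne'))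
  filter_upwards [Metric.tendstoUniformlyOn_iff.1 hlim (‖F x‖ / 2) (half_pos hm)] with i hi
  by_contra! hzero
  have hdiff : DiffContOnCl ℂ (f i) (Metric.ball w r) :=
    ((hf i).mono fun z hz ↦ (hball hz).1.1).diffContOnCl_ball subset_rfl
  have hinv : ‖(f i w)⁻¹‖ ≤ (‖F x‖ / 2)⁻¹ := by
    refine Complex.norm_le_of_forall_mem_frontier_norm_le Metric.isBounded_ball
      (hdiff.inv fun z hz ↦ ?_) (fun z hz ↦ ?_) (subset_closure (Metric.mem_ball_self hr))
    · rw [closure_ball w hr.ne'] at hz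
      exact hzero z (hball hz).1.2
    · rw [frontier_ball w hr.ne'] at hz
      have hFz : ‖F x‖ ≤ ‖F z‖ := hmin hz
      have hfz := hi z (hsphere hz).1.1
      rw [dist_eq_norm] at hfz
      rw [Pi.inv_apply, norm_inv]
      gcongr
      linarith [norm_sub_norm_le (F z) (f i z)]
  have hwball := (hball (Metric.mem_closedBall_self hr.le)).1
  have hfw := hi w hwball.1
  rw [hFw, dist_zero_left] at hfw
  rw [norm_inv, inv_le_inv₀ (norm_pos_iff.2 (hzero w hwball.2)) (half_pos hm)] at hinv
  exact hfw.not_ge hinv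

theorem exists_analyticAt_pow_eq {f : ℂ → ℂ} {w s₀ : ℂ} {n : ℕ} (hn : n ≠ 0)
    (hf : AnalyticAt ℂ f w) (hs₀ : s₀ ≠ 0) (hfw : s₀ ^ n = f w) :
    ∃ s : ℂ → ℂ, AnalyticAt ℂ s w ∧ s w = s₀ ∧ ∀ z, s z ^ n = f z := by
  have hfw₀ : f w ≠ 0 := hfw ▸ pow_ne_zero n hs₀
  refine ⟨fun z ↦ s₀ * (f z / f w) ^ ((n : ℂ)⁻¹), ?_, by simp [hfw₀], fun z ↦ ?_⟩
  · exact analyticAt_const.mul ((hf.div_const).cpow analyticAt_const (by simp [hfw₀]))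
  · rw [mul_pow, Complex.cpow_nat_inv_pow _ hn, hfw, mul_div_cancel₀ _ hfw₀]

theorem tendsto_pow_nhds_zero_of_norm_lt_one {𝕜 : Type*} [NormedField 𝕜] {q : ℕ → 𝕜} {q₀ : 𝕜}
    (hq : Tendsto q atTop (𝓝 q₀)) (hlt : ‖q₀‖ < 1) :
    Tendsto (fun n ↦ q n ^ n) atTop (𝓝 0) := by
  obtain ⟨ρ, hρ, hρ₁⟩ := exists_between hlt
  refine squeeze_zero_norm' ?_
    (tendsto_pow_atTop_nhds_zero_of_lt_one ((norm_nonneg q₀).trans hρ.le) hρ₁)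
  filter_upwards [hq.norm.eventually_lt_const hρ] with n hn
  rw [norm_pow]
  gcongr

theorem eq_zero_of_eventually_mul_pow_add_mul_pow_eq_zero {𝕜 : Type*} [NormedField 𝕜]
    {α β u v : ℕ → 𝕜} {α₀ β₀ u₀ v₀ : 𝕜} (hα : Tendsto α atTop (𝓝 α₀))
    (hβ : Tendsto β atTop (𝓝 β₀)) (hu : Tendsto u atTop (𝓝 u₀)) (hv : Tendsto v atTop (𝓝 v₀))
    (hlt : ‖v₀‖ < ‖u₀‖) (h : ∀ᶠ n in atTop, α n * u n ^ n + β n * v n ^ n = 0) : α₀ = 0 := by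
  have hu₀ : u₀ ≠ 0 := norm_pos_iff.1 ((norm_nonneg v₀).trans_lt hlt)
  have hq : Tendsto (fun n ↦ (v n / u n) ^ n) atTop (𝓝 0) :=
    tendsto_pow_nhds_zero_of_norm_lt_one (hv.div hu hu₀) <| by
      rwa [norm_div, div_lt_one (norm_pos_iff.2 hu₀)]
  have hαq : ∀ᶠ n in atTop, -(β n * (v n / u n) ^ n) = α n := by
    filter_upwards [h, hu.eventually_ne hu₀] with n hn hun
    rw [div_pow]
    field_simp
    linear_combination -hn
  simpa using tendsto_nhds_unique hα ((hβ.mul hq).neg.congr' hαq)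

theorem norm_log_le_abs_log_norm_add_pi (z : ℂ) : ‖Complex.log z‖ ≤ |Real.log ‖z‖| + π := by
  refine (Complex.norm_le_abs_re_add_abs_im _).trans ?_
  rw [Complex.log_re, Complex.log_im]
  gcongr
  exact Complex.abs_arg_le_pi z

theorem pow_eq_of_mul_log_eq {q r q₀ r₀ : ℂ} {n : ℕ} (hq : q ≠ 0) (hr : r ≠ 0) (hq₀ : q₀ ≠ 0)
    (hr₀ : r₀ ≠ 0)
    (hlog : n * Complex.log (q / q₀) = Complex.log (r / r₀) + Complex.log (r₀ / q₀ ^ n)) :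
    q ^ n = r := by
  have hexp := congrArg Complex.exp hlog
  rw [Complex.exp_add, Complex.exp_nat_mul, Complex.exp_log (div_ne_zero hq hq₀),
    Complex.exp_log (div_ne_zero hr hr₀), Complex.exp_log (div_ne_zero hr₀ (pow_ne_zero n hq₀)),
    div_pow] at hexp
  field_simp at hexp
  exact hexp

section BerahaKahaneWeiss

variable {α β u v : ℂ → ℂ} {w : ℂ} {V : Set ℂ}

theorem eventually_exists_mul_pow_add_mul_pow_eq_zero_of_norm_lt (hα : AnalyticAt ℂ α w)
    (hβ : AnalyticAt ℂ β w) (hu : AnalyticAt ℂ u w) (hv : AnalyticAt ℂ v w)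
    (hlt : ‖v w‖ < ‖u w‖) (hαw : α w = 0) (hα₀ : ¬ ∀ᶠ z in 𝓝 w, α z = 0) (hV : V ∈ 𝓝 w) :
    ∀ᶠ n : ℕ in atTop, ∃ z ∈ V, α z * u z ^ n + β z * v z ^ n = 0 := by
  have huw : u w ≠ 0 := norm_pos_iff.1 ((norm_nonneg _).trans_lt hlt)
  have hq : AnalyticAt ℂ (v / u) w := hv.div hu huw
  have hqw : ‖(v / u) w‖ < 1 := by
    rwa [Pi.div_apply, norm_div, div_lt_one (norm_pos_iff.2 huw)]
  obtain ⟨ρ, hρ, hρ₁⟩ := exists_between hqw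
  obtain ⟨K, hK⟩ := exists_gt ‖β w‖
  have hK₀ : 0 ≤ K := (norm_nonneg _).trans hK.le
  have hU : ∀ᶠ z in 𝓝 w, AnalyticAt ℂ α z ∧ AnalyticAt ℂ β z ∧ AnalyticAt ℂ (v / u) z ∧
      ‖(v / u) z‖ < ρ ∧ ‖β z‖ < K :=
    hα.eventually_analyticAt.and <| hβ.eventually_analyticAt.and <| hq.eventually_analyticAt.and <|
      (hq.continuousAt.norm.eventually_lt_const hρ).and
        (hβ.continuousAt.norm.eventually_lt_const hK)
  have hzero := eventually_exists_mem_eq_zero_of_tendstoUniformlyOn (l := atTop)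
    (f := fun (n : ℕ) z ↦ α z + β z * (v / u) z ^ n) hU
    (inter_mem hV (hu.continuousAt.eventually_ne huw)) ?_ ?_ hα hαw hα₀
  · filter_upwards [hzero] with n ⟨z, ⟨hzV, huz⟩, hz⟩
    refine ⟨z, hzV, ?_⟩
    rw [Pi.div_apply, div_pow] at hz
    replace huz : u z ≠ 0 := huz
    field_simp at hz
    linear_combination hz
  · exact fun n z ⟨hαz, hβz, hqz, _⟩ ↦
      (hαz.add (hβz.mul (hqz.pow n))).differentiableAt.differentiableWithinAt
  · refine Metric.tendstoUniformlyOn_iff.2 fun ε hε ↦ ?_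
    have hbound := (tendsto_pow_atTop_nhds_zero_of_lt_one ((norm_nonneg _).trans hρ.le)
      hρ₁).const_mul K
    rw [mul_zero] at hbound
    filter_upwards [hbound.eventually_lt_const hε] with n hn z ⟨_, _, _, hqz, hβz⟩
    rw [dist_self_add_right, norm_mul, norm_pow]
    refine lt_of_le_of_lt ?_ hn
    gcongr

/-- The equation `q ^ n = r` is `log (q / q w) = (log (r / r w) + κ n) / n`, where
`κ n = log (r w / q w ^ n)` is bounded, and its right side tends to `0` uniformly. -/
theorem eventually_exists_pow_eq_of_norm_eq_one {q r : ℂ → ℂ} (hq : AnalyticAt ℂ q w)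
    (hr : AnalyticAt ℂ r w) (hqw : ‖q w‖ = 1) (hrw : r w ≠ 0)
    (hne : ¬ ∀ᶠ z in 𝓝 w, q z = q w) (hV : V ∈ 𝓝 w) :
    ∀ᶠ n : ℕ in atTop, ∃ z ∈ V, q z ^ n = r z := by
  have hqw₀ : q w ≠ 0 := norm_ne_zero_iff.1 (by simp [hqw])
  have hl : AnalyticAt ℂ (fun z ↦ Complex.log (q z / q w)) w := hq.div_const.clog (by simp [hqw₀])
  have hm : AnalyticAt ℂ (fun z ↦ Complex.log (r z / r w)) w := hr.div_const.clog (by simp [hrw])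
  set κ : ℕ → ℂ := fun n ↦ Complex.log (r w / q w ^ n)
  have hκ (n : ℕ) : ‖κ n‖ ≤ |Real.log ‖r w‖| + π := by
    simpa [hqw] using norm_log_le_abs_log_norm_add_pi (r w / q w ^ n)
  have hU : ∀ᶠ z in 𝓝 w, AnalyticAt ℂ (fun z ↦ Complex.log (q z / q w)) z ∧
      AnalyticAt ℂ (fun z ↦ Complex.log (r z / r w)) z ∧ ‖Complex.log (r z / r w)‖ < 1 :=
    hl.eventually_analyticAt.and <| hm.eventually_analyticAt.and <|
      hm.continuousAt.norm.eventually_lt_const (by simp [hrw])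
  have hqr : ∀ᶠ z in 𝓝 w, q z ≠ 0 ∧ r z ≠ 0 :=
    (hq.continuousAt.eventually_ne hqw₀).and (hr.continuousAt.eventually_ne hrw)
  have hzero := eventually_exists_mem_eq_zero_of_tendstoUniformlyOn (l := atTop)
    (f := fun (n : ℕ) z ↦ Complex.log (q z / q w) - (Complex.log (r z / r w) + κ n) / n) hU
    (inter_mem hV hqr) ?_ ?_ hl (by simp [hqw₀]) ?_
  · filter_upwards [hzero, eventually_ne_atTop 0] with n ⟨z, ⟨hzV, hqz, hrz⟩, hz⟩ hn
    refine ⟨z, hzV, ?_⟩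
    refine pow_eq_of_mul_log_eq hqz hrz hqw₀ hrw ?_
    rw [sub_eq_zero.1 hz, mul_div_cancel₀ _ (Nat.cast_ne_zero.2 hn)]
  · exact fun n z ⟨hlz, hmz, _⟩ ↦
      (hlz.sub ((hmz.add analyticAt_const).div_const)).differentiableAt.differentiableWithinAt
  · refine Metric.tendstoUniformlyOn_iff.2 fun ε hε ↦ ?_
    filter_upwards [(tendsto_const_div_atTop_nhds_zero_nat
      (1 + (|Real.log ‖r w‖| + π))).eventually_lt_const hε] with n hn z ⟨_, _, hmz⟩
    rw [dist_self_sub_right, norm_div, Complex.norm_natCast]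
    refine lt_of_le_of_lt ?_ hn
    gcongr
    exact (norm_add_le _ _).trans (add_le_add hmz.le (hκ n))
  · refine fun hlog ↦ hne ?_
    filter_upwards [hlog, hqr] with z hz ⟨hqz, _⟩
    rw [← div_eq_one_iff_eq hqw₀, ← Complex.exp_log (div_ne_zero hqz hqw₀), hz, Complex.exp_zero]

theorem eventually_exists_mul_pow_add_mul_pow_eq_zero_of_norm_eq (hα : AnalyticAt ℂ α w)
    (hβ : AnalyticAt ℂ β w) (hu : AnalyticAt ℂ u w) (hv : AnalyticAt ℂ v w)
    (heq : ‖v w‖ = ‖u w‖) (huw : u w ≠ 0) (hαw : α w ≠ 0) (hβw : β w ≠ 0)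
    (hne : ¬ ∀ᶠ z in 𝓝 w, v z / u z = v w / u w) (hV : V ∈ 𝓝 w) :
    ∀ᶠ n : ℕ in atTop, ∃ z ∈ V, α z * u z ^ n + β z * v z ^ n = 0 := by
  have hzero := eventually_exists_pow_eq_of_norm_eq_one (hv.div hu huw) (hα.neg.div hβ hβw)
    (by simp [heq, huw]) (by simp [hαw, hβw]) hne (inter_mem hV
      ((hu.continuousAt.eventually_ne huw).and (hβ.continuousAt.eventually_ne hβw)))
  filter_upwards [hzero] with n ⟨z, ⟨hzV, huz, hβz⟩, hz⟩
  refine ⟨z, hzV, ?_⟩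
  simp only [Pi.div_apply, Pi.neg_apply, div_pow] at hz
  field_simp at hz
  linear_combination hz

end BerahaKahaneWeiss

/-! ### Limits of zeros and plane geometry -/

theorem exists_tendsto_iff_forall_nhds_eventually_exists_mem {X : Type*} [PseudoMetricSpace X]
    {Z : ℕ → Set X} {k : ℕ} (hZ : ∀ n, k ≤ n → (Z n).Nonempty) {w : X} :
    (∃ z : ℕ → X, (∀ n, k ≤ n → z n ∈ Z n) ∧ Tendsto z atTop (𝓝 w)) ↔
      ∀ V ∈ 𝓝 w, ∀ᶠ n in atTop, ∃ z ∈ V, z ∈ Z n := by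
  constructor
  · rintro ⟨z, hz, hlim⟩ V hV
    filter_upwards [hlim hV, eventually_ge_atTop k] with n hn hkn
    exact ⟨z n, hn, hz n hkn⟩
  · intro H
    have hnear : ∀ n, ∃ z, k ≤ n → z ∈ Z n ∧ dist w z < Metric.infDist w (Z n) + 1 / (n + 1) := by
      intro n
      by_cases hn : k ≤ n
      · obtain ⟨z, hz, hdist⟩ := (Metric.infDist_lt_iff (hZ n hn)).1
          (lt_add_of_pos_right (Metric.infDist w (Z n)) (Nat.one_div_pos_of_nat (α := ℝ) (n := n)))
        exact ⟨z, fun _ ↦ ⟨hz, hdist⟩⟩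
      · exact ⟨w, fun h ↦ absurd h hn⟩
    choose z hz using hnear
    have hinf : Tendsto (fun n ↦ Metric.infDist w (Z n)) atTop (𝓝 0) := by
      refine Metric.tendsto_nhds.2 fun ε hε ↦ ?_
      filter_upwards [H _ (Metric.ball_mem_nhds w hε)] with n ⟨y, hy, hyZ⟩
      rw [Real.dist_0_eq_abs, abs_of_nonneg Metric.infDist_nonneg]
      exact (Metric.infDist_le_dist_of_mem hyZ).trans_lt (Metric.mem_ball'.1 hy)
    have hbound := hinf.add (tendsto_one_div_add_atTop_nhds_zero_nat (𝕜 := ℝ))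
    rw [add_zero] at hbound
    refine ⟨z, fun n hn ↦ (hz n hn).1, tendsto_iff_dist_tendsto_zero.2 <|
      squeeze_zero' (.of_forall fun _ ↦ dist_nonneg) ?_ hbound⟩
    filter_upwards [eventually_ge_atTop k] with n hn
    rw [dist_comm]
    exact (hz n hn).2.le

theorem isClosed_setOf_forall_nhds_eventually_exists_mem {X ι : Type*} [TopologicalSpace X]
    {l : Filter ι} (Z : ι → Set X) :
    IsClosed {w | ∀ V ∈ 𝓝 w, ∀ᶠ i in l, ∃ z ∈ V, z ∈ Z i} := by
  refine isClosed_of_closure_subset fun w hw V hV ↦ ?_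
  obtain ⟨y, hyV, hy⟩ := mem_closure_iff_nhds.1 hw _ (interior_mem_nhds.2 hV)
  filter_upwards [hy _ (isOpen_interior.mem_nhds hyV)] with i ⟨z, hz, hzZ⟩
  exact ⟨z, interior_subset hz, hzZ⟩

theorem eventually_quadratic_ne_zero {p q r : ℂ} (hne : ¬ (p = 0 ∧ q = 0 ∧ r = 0)) (w : ℂ) :
    ∀ᶠ z in 𝓝[≠] w, p * z ^ 2 + q * z + r ≠ 0 := by
  have hP : C p * X ^ 2 + C q * X + C r ≠ 0 := by
    refine fun h ↦ hne ⟨?_, ?_, ?_⟩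
    · simpa [coeff_X, coeff_C] using congrArg (coeff · 2) h
    · simpa [coeff_X, coeff_C] using congrArg (coeff · 1) h
    · simpa [coeff_X, coeff_C] using congrArg (coeff · 0) h
  filter_upwards [nhdsNE_le_cofinite w (finite_setOfPred_isRoot hP).eventually_cofinite_notMem]
    with z hz h
  exact hz (by simpa [IsRoot] using h)

theorem frequently_nhdsNE_comp_of_analyticAt {f : ℂ → ℂ} {w : ℂ} {p : ℂ → Prop}
    (hf : AnalyticAt ℂ f w) (hne : ¬ ∀ᶠ z in 𝓝 w, f z = f w) (hp : ∃ᶠ y in 𝓝[≠] f w, p y) :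
    ∃ᶠ z in 𝓝[≠] w, p (f z) := by
  have hopen := hf.eventually_constant_or_nhds_le_map_nhds.resolve_left hne
  rw [frequently_nhdsWithin_iff] at hp ⊢
  exact (frequently_map.1 (hp.filter_mono hopen)).mono
    fun z ⟨hz, hne⟩ ↦ ⟨hz, fun h ↦ hne (congrArg f h)⟩

theorem preperfect_ofReal_image_Icc : Preperfect (((↑) : ℝ → ℂ) '' Set.Icc 0 1) :=
  (isPreconnected_Icc.image _ Complex.continuous_ofReal.continuousOn).preperfect_of_nontrivial
    ⟨0, ⟨0, by simp⟩, 1, ⟨1, by simp⟩, zero_ne_one⟩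

section InnerProductSpace

variable {E : Type*} [SeminormedAddCommGroup E] [InnerProductSpace ℝ E] {x y : E}

theorem norm_add_lt_norm_sub_iff_inner_neg : ‖x + y‖ < ‖x - y‖ ↔ inner ℝ x y < 0 := by
  rw [← sq_lt_sq₀ (norm_nonneg _) (norm_nonneg _), norm_add_sq_real, norm_sub_sq_real]
  constructor <;> intro h <;> linarith

theorem norm_sub_eq_norm_add_iff_inner_eq_zero : ‖x - y‖ = ‖x + y‖ ↔ inner ℝ x y = 0 := by
  rw [← sq_eq_sq₀ (norm_nonneg _) (norm_nonneg _), norm_add_sq_real, norm_sub_sq_real]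
  constructor <;> intro h <;> linarith

end InnerProductSpace

theorem norm_sub_eq_norm_add_iff_zero_mem_segment {u s : ℂ} :
    ‖u - s‖ = ‖u + s‖ ↔ 0 ∈ segment ℝ (u ^ 2) (s ^ 2) := by
  rcases eq_or_ne u 0 with rfl | hu
  · simp [left_mem_segment]
  obtain ⟨ρ, rfl⟩ : ∃ ρ, s = ρ * u := ⟨s / u, (div_mul_cancel₀ s hu).symm⟩
  have hnorm : ‖u - ρ * u‖ = ‖u + ρ * u‖ ↔ ρ.re = 0 := by
    rw [norm_sub_eq_norm_add_iff_inner_eq_zero, Complex.inner, mul_assoc, Complex.mul_conj,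
      Complex.re_mul_ofReal]
    simp [hu]
  rw [hnorm, mem_segment_iff_sameRay, zero_sub, sub_zero, mul_pow]
  constructor
  · intro hre
    have hρ : ρ = ρ.im * Complex.I := Complex.ext (by simp [hre]) (by simp)
    have hsq : ρ ^ 2 * u ^ 2 = ρ.im ^ 2 • -u ^ 2 := by
      rw [Complex.real_smul]
      push_cast
      linear_combination (ρ + ρ.im * Complex.I) * u ^ 2 * hρ + ρ.im ^ 2 * u ^ 2 * Complex.I_sq
    rw [hsq]
    exact SameRay.sameRay_nonneg_smul_right _ (sq_nonneg _)
  · intro hray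
    obtain ⟨r, hr, hru⟩ := hray.exists_nonneg_left (neg_ne_zero.2 (pow_ne_zero 2 hu))
    have hsq : ρ ^ 2 = ((-r : ℝ) : ℂ) := by
      rw [Complex.real_smul] at hru
      refine mul_right_cancel₀ (pow_ne_zero 2 hu) ?_
      push_cast
      linear_combination -hru
    have hre := congrArg Complex.re hsq
    have him := congrArg Complex.im hsq
    rw [sq, Complex.mul_re, Complex.ofReal_re] at hre
    rw [sq, Complex.mul_im, Complex.ofReal_im] at him
    rcases mul_eq_zero.1 (show ρ.re * ρ.im = 0 by linarith) with h | h
    · exact h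
    · rw [h] at hre
      exact mul_self_eq_zero.1 (le_antisymm (by linarith) (mul_self_nonneg _))

theorem sqrt_sq (z : ℂ) : Complex.sqrt z ^ 2 = z := by
  simp [Complex.sqrt]

theorem re_eq_zero_and_im_sq_of_sq_eq_ofReal {w : ℂ} {r : ℝ} (hr : r < 0) (hw : w ^ 2 = r) :
    w.re = 0 ∧ w.im ^ 2 = -r := by
  have hre : w.re ^ 2 - w.im ^ 2 = r := by simpa [pow_two] using congrArg Complex.re hw
  have him : w.re * w.im = 0 := by
    have him' : w.re * w.im + w.im * w.re = 0 := by simpa [pow_two] using congrArg Complex.im hw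
    linarith
  rcases mul_eq_zero.1 him with h₀ | h₀
  · rw [h₀] at hre
    exact ⟨h₀, by linarith⟩
  · rw [h₀] at hre
    linarith [sq_nonneg w.re]

theorem exists_mem_Icc_add_mul_eq_zero_iff {K : Type*} [Field K] [LinearOrder K]
    [IsStrictOrderedRing K] {p q : K} (hp : 0 ≤ p) :
    (∃ θ ∈ Set.Icc (0 : K) 1, p + θ * q = 0) ↔ p = 0 ∨ p + q ≤ 0 := by
  constructor
  · rintro ⟨θ, ⟨hθ₀, hθ₁⟩, hθ⟩
    rcases le_or_gt 0 q with hq | hq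
    · exact .inl (by linarith [mul_nonneg hθ₀ hq])
    · exact .inr (by linarith [mul_nonneg (sub_nonneg.2 hθ₁) (neg_nonneg.2 hq.le)])
  · rintro (rfl | hpq)
    · exact ⟨0, by simp, by simp⟩
    · rcases hp.eq_or_lt with rfl | hp
      · exact ⟨0, by simp, by simp⟩
      · have hq : 0 < -q := by linarith
        refine ⟨p / -q, ⟨by positivity, (div_le_one hq).2 (by linarith)⟩, ?_⟩
        field_simp [neg_ne_zero.1 hq.ne']
        ring

theorem wSameSide_iff_mul_nonneg {R V P : Type*} [Field R] [LinearOrder R] [IsStrictOrderedRing R]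
    [AddCommGroup V] [Module R V] [AddTorsor V P] {s : AffineSubspace R P} {f : P →ᵃ[R] R}
    (hs : ∀ p, p ∈ s ↔ f p = 0) (hne : (s : Set P).Nonempty) {x y : P} :
    s.WSameSide x y ↔ 0 ≤ f x * f y := by
  constructor
  · rintro ⟨p, hp, q, hq, hray⟩
    have hf : SameRay R (f x) (f y) := by
      simpa [(hs p).1 hp, (hs q).1 hq] using hray.map f.linear
    rcases eq_or_ne (f x) 0 with hx | hx
    · simp [hx]
    · obtain ⟨r, hr, hy⟩ := hf.exists_nonneg_left hx
      rw [← hy, smul_eq_mul, mul_left_comm]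
      exact mul_nonneg hr (mul_self_nonneg _)
  · intro hxy
    obtain ⟨p, hp⟩ := hne
    by_cases hx : f x = 0
    · exact AffineSubspace.wSameSide_of_left_mem y ((hs x).2 hx)
    · refine AffineSubspace.wSameSide_of_vsub_eq_smul (p₂ := -(f y / f x) • (x -ᵥ p) +ᵥ y)
        (c₁ := 1) (c₂ := f y / f x) hp ((hs _).2 ?_) (one_smul R _).symm ?_ ?_
      · simp [(hs p).1 hp, hx]
      · simp [vsub_vadd_eq_vsub_sub]
      · simpa using div_nonneg_iff.2 (mul_nonneg_iff.1 (mul_comm (f x) _ ▸ hxy))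

theorem mem_affineSpan_pair_iff_re_eq {p q z : ℂ} (hpq : p ≠ q) (hre : p.re = q.re) :
    z ∈ line[ℝ, p, q] ↔ z.re = p.re := by
  have him : q.im - p.im ≠ 0 := sub_ne_zero.2 fun him ↦ hpq (Complex.ext hre him.symm)
  rw [mem_affineSpan_pair_iff_exists_lineMap_eq]
  constructor
  · rintro ⟨t, rfl⟩
    simp [AffineMap.lineMap_apply, hre]
  · intro hz
    obtain ⟨t, ht⟩ : ∃ t : ℝ, t * (q.im - p.im) = z.im - p.im := ⟨_, div_mul_cancel₀ _ him⟩
    refine ⟨t, Complex.ext ?_ ?_⟩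
    · simp [AffineMap.lineMap_apply, hre, hz]
    · simp [AffineMap.lineMap_apply, ht]

theorem wSameSide_affineSpan_pair_iff_of_re_eq {p q w z : ℂ} (hpq : p ≠ q) (hre : p.re = q.re) :
    (line[ℝ, p, q]).WSameSide w z ↔ 0 ≤ (w.re - p.re) * (z.re - p.re) :=
  wSameSide_iff_mul_nonneg (f := Complex.reLm.toAffineMap - AffineMap.const ℝ ℂ p.re)
    (fun _ ↦ (mem_affineSpan_pair_iff_re_eq hpq hre).trans sub_eq_zero.symm)
    ⟨p, left_mem_affineSpan_pair ℝ p q⟩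

theorem cospherical_insert_iff_mem_sphere {V P : Type*} [NormedAddCommGroup V]
    [InnerProductSpace ℝ V] [MetricSpace P] [NormedAddTorsor V P] [FiniteDimensional ℝ V]
    (hV : Module.finrank ℝ V = 2) {S : EuclideanGeometry.Sphere P} {p q r z : P} (hp : p ∈ S)
    (hq : q ∈ S) (hr : r ∈ S) (hpq : p ≠ q) (hpr : p ≠ r) (hqr : q ≠ r) :
    EuclideanGeometry.Cospherical {p, q, r, z} ↔ z ∈ S := by
  rw [EuclideanGeometry.cospherical_iff_exists_sphere]
  constructor
  · rintro ⟨T, hT⟩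
    obtain ⟨hpT, hqT, hrT, hzT⟩ : p ∈ T ∧ q ∈ T ∧ r ∈ T ∧ z ∈ T := by
      simpa [Set.insert_subset_iff] using hT
    have hST : S = T := by
      by_contra hne
      rcases EuclideanGeometry.eq_of_mem_sphere_of_mem_sphere_of_finrank_eq_two hV hne hpq
        hp hq hr hpT hqT hrT with hrp | hrq
      exacts [hpr hrp.symm, hqr hrq.symm]
    rwa [hST]
  · intro hz
    exact ⟨S, by simp [Set.insert_subset_iff, hp, hq, hr, hz]⟩

/-! ### The zeros of `W n` -/

variable {a b c d : ℝ}

theorem eval_W_add_two (n : ℕ) (z : ℂ) : (W a b c d (n + 2)).eval z =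
    A a b z * (W a b c d (n + 1)).eval z + B c d z * (W a b c d n).eval z := by
  simp [W, A, B]

theorem two_pow_mul_mul_eval_W {z s : ℂ} (hs : s ^ 2 = Delta a b c d z) (n : ℕ) :
    2 ^ (n + 1) * s * (W a b c d n).eval z =
      (s + h a b z) * (A a b z + s) ^ n + (s - h a b z) * (A a b z - s) ^ n := by
  induction n using Nat.twoStepInduction with
  | zero =>
    rw [W, eval_one]
    ring
  | one =>
    rw [W, eval_X, h, A]
    ring
  | more n ih₀ ih₁ =>
    rw [eval_W_add_two]
    have hB : 4 * B c d z = s ^ 2 - A a b z ^ 2 := by rw [hs, Delta]; ring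
    linear_combination (2 * A a b z) * ih₁ + (s ^ 2 - A a b z ^ 2) * ih₀ +
      2 ^ (n + 1) * s * (W a b c d n).eval z * hB

theorem isRoot_W_iff {z s : ℂ} (hs : s ^ 2 = Delta a b c d z) (hs₀ : s ≠ 0) (n : ℕ) :
    (W a b c d n).IsRoot z ↔
      (s + h a b z) * (A a b z + s) ^ n + (s - h a b z) * (A a b z - s) ^ n = 0 := by
  rw [← two_pow_mul_mul_eval_W hs]
  simp [IsRoot, hs₀]

theorem degree_W (ha : a ≠ 0) (n : ℕ) : (W a b c d n).degree = n := by
  have ha' : (a : ℂ) ≠ 0 := mod_cast ha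
  induction n using Nat.twoStepInduction with
  | zero => simp [W]
  | one => simp [W]
  | more n ih₀ ih₁ =>
    have hA : ((C (a : ℂ) * X + C (b : ℂ)) * W a b c d (n + 1)).degree =
        ((n + 2 : ℕ) : WithBot ℕ) := by
      rw [degree_mul, degree_linear ha', ih₁]
      norm_cast
      ring
    have hB : ((C (c : ℂ) * X + C (d : ℂ)) * W a b c d n).degree < ((n + 2 : ℕ) : WithBot ℕ) := by
      rw [degree_mul, ih₀]
      refine (add_le_add_left degree_linear_le _).trans_lt ?_
      norm_cast
      lia
    rw [← hA]
    exact degree_add_eq_left_of_degree_lt (hB.trans_eq hA.symm)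

theorem isLimitOfZeros_iff (ha : a ≠ 0) {w : ℂ} : IsLimitOfZeros a b c d w ↔
    ∀ V ∈ 𝓝 w, ∀ᶠ n in atTop, ∃ z ∈ V, (W a b c d n).IsRoot z := by
  refine exists_tendsto_iff_forall_nhds_eventually_exists_mem
    (Z := fun n ↦ {z | (W a b c d n).IsRoot z}) fun n hn ↦ Complex.exists_root ?_
  rw [degree_W ha]
  exact_mod_cast hn

theorem isClosed_setOf_isLimitOfZeros (ha : a ≠ 0) :
    IsClosed {w | IsLimitOfZeros a b c d w} := by
  simp only [isLimitOfZeros_iff ha]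
  exact isClosed_setOf_forall_nhds_eventually_exists_mem fun n ↦ {z | (W a b c d n).IsRoot z}

theorem analyticAt_A (z : ℂ) : AnalyticAt ℂ (A a b) z := by
  unfold A; fun_prop

theorem analyticAt_B (z : ℂ) : AnalyticAt ℂ (B c d) z := by
  unfold B; fun_prop

theorem analyticAt_h (z : ℂ) : AnalyticAt ℂ (h a b) z := by
  unfold h; fun_prop

theorem analyticAt_Delta (z : ℂ) : AnalyticAt ℂ (Delta a b c d) z :=
  ((analyticAt_A z).pow 2).add (analyticAt_const.mul (analyticAt_B z))

theorem add_h_mul_sub_h {z s : ℂ} (hs : s ^ 2 = Delta a b c d z) :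
    (s + h a b z) * (s - h a b z) = -4 * g a b c d z := by
  simp only [Delta, h, g, A, B] at hs ⊢
  linear_combination hs

theorem eventually_g_ne_zero (hnd : ¬ (a = 1 ∧ b + c = 0 ∧ d = 0)) (w : ℂ) :
    ∀ᶠ z in 𝓝[≠] w, g a b c d z ≠ 0 := by
  have hcoeff : ¬ ((a - 1 : ℂ) = 0 ∧ (b + c : ℂ) = 0 ∧ (d : ℂ) = 0) := fun ⟨h₂, h₁, h₀⟩ ↦
    hnd ⟨Complex.ofReal_injective (sub_eq_zero.1 h₂), mod_cast h₁, mod_cast h₀⟩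
  filter_upwards [eventually_quadratic_ne_zero hcoeff w] with z hz hg
  exact hz (by rw [← neg_eq_zero, ← hg, g]; ring)

theorem eventually_A_sq_add_mul_B_ne_zero (ha : a ≠ 0) (b c d : ℝ) (τ w : ℂ) :
    ∀ᶠ z in 𝓝[≠] w, A a b z ^ 2 + τ * B c d z ≠ 0 := by
  have hcoeff : ¬ ((a ^ 2 : ℂ) = 0 ∧ 2 * a * b + τ * c = 0 ∧ b ^ 2 + τ * d = 0) :=
    fun ⟨h₂, _⟩ ↦ pow_ne_zero 2 (Complex.ofReal_ne_zero.2 ha) h₂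
  filter_upwards [eventually_quadratic_ne_zero hcoeff w] with z hz hAB
  exact hz (by rw [← hAB, A, B]; ring)

theorem IsLimitOfZeros.add_h_eq_zero {w s₀ : ℂ} (hw : IsLimitOfZeros a b c d w)
    (hs₀ : s₀ ^ 2 = Delta a b c d w) (hlt : ‖A a b w - s₀‖ < ‖A a b w + s₀‖) :
    s₀ + h a b w = 0 := by
  have hs₀' : s₀ ≠ 0 := by rintro rfl; simp at hlt
  obtain ⟨s, hs, rfl, hsq⟩ := exists_analyticAt_pow_eq two_ne_zero (analyticAt_Delta w) hs₀' hs₀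
  obtain ⟨z, hz, hlim⟩ := hw
  have hsz := hs.continuousAt.tendsto.comp hlim
  have hAz := (analyticAt_A (a := a) (b := b) w).continuousAt.tendsto.comp hlim
  have hhz := (analyticAt_h (a := a) (b := b) w).continuousAt.tendsto.comp hlim
  refine eq_zero_of_eventually_mul_pow_add_mul_pow_eq_zero (hsz.add hhz) (hsz.sub hhz)
    (hAz.add hsz) (hAz.sub hsz) hlt ?_
  filter_upwards [eventually_ge_atTop 1, hsz.eventually_ne hs₀'] with n hn hsn
  exact (isRoot_W_iff (hsq _) hsn n).1 (hz n hn)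

theorem isLimitOfZeros_of_add_h_eq_zero (ha : a ≠ 0) (hnd : ¬ (a = 1 ∧ b + c = 0 ∧ d = 0))
    {w s₀ : ℂ} (hs₀ : s₀ ^ 2 = Delta a b c d w) (hlt : ‖A a b w - s₀‖ < ‖A a b w + s₀‖)
    (h₀ : s₀ + h a b w = 0) : IsLimitOfZeros a b c d w := by
  have hs₀' : s₀ ≠ 0 := by rintro rfl; simp at hlt
  obtain ⟨s, hs, rfl, hsq⟩ := exists_analyticAt_pow_eq two_ne_zero (analyticAt_Delta w) hs₀' hs₀
  have hsh : ¬ ∀ᶠ z in 𝓝 w, s z + h a b z = 0 :=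
    not_eventually.2 <| ((eventually_g_ne_zero hnd w).frequently.filter_mono
      nhdsWithin_le_nhds).mono fun z hg hz ↦ hg (by simpa [hz] using add_h_mul_sub_h (hsq z))
  refine (isLimitOfZeros_iff ha).2 fun V hV ↦ ?_
  filter_upwards [eventually_exists_mul_pow_add_mul_pow_eq_zero_of_norm_lt
    (hs.add (analyticAt_h w)) (hs.sub (analyticAt_h w)) ((analyticAt_A w).add hs)
    ((analyticAt_A w).sub hs) hlt h₀ hsh
    (inter_mem hV (hs.continuousAt.eventually_ne hs₀'))] with n
  rintro ⟨z, ⟨hzV, hsz⟩, hz⟩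
  exact ⟨z, hzV, (isRoot_W_iff (hsq z) hsz n).2 hz⟩

theorem not_eventually_div_eq_const (ha : a ≠ 0) {s : ℂ → ℂ} {w κ : ℂ} (hκ : κ ≠ 0)
    (hs : ∀ z, s z ^ 2 = Delta a b c d z) (hne : ∀ᶠ z in 𝓝 w, A a b z + s z ≠ 0) :
    ¬ ∀ᶠ z in 𝓝 w, (A a b z - s z) / (A a b z + s z) = κ := by
  intro hconst
  obtain ⟨z, ⟨hκz, hz⟩, hAB⟩ := (((hconst.and hne).filter_mono nhdsWithin_le_nhds).and
    (eventually_A_sq_add_mul_B_ne_zero ha b c d ((1 + κ) ^ 2 / κ) w)).exists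
  refine hAB ?_
  rw [div_eq_iff hz] at hκz
  have hsq : A a b z ^ 2 * (1 - κ) ^ 2 = Delta a b c d z * (1 + κ) ^ 2 := by
    rw [← hs, ← mul_pow, ← mul_pow]
    congr 1
    linear_combination hκz
  rw [Delta] at hsq
  field_simp
  linear_combination -hsq / 4

theorem isLimitOfZeros_of_norm_sub_eq_norm_add (ha : a ≠ 0) {w s₀ : ℂ}
    (hs₀ : s₀ ^ 2 = Delta a b c d w) (hs₀' : s₀ ≠ 0) (heq : ‖A a b w - s₀‖ = ‖A a b w + s₀‖)
    (hg : g a b c d w ≠ 0) : IsLimitOfZeros a b c d w := by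
  obtain ⟨s, hs, rfl, hsq⟩ := exists_analyticAt_pow_eq two_ne_zero (analyticAt_Delta w) hs₀' hs₀
  have hprod : (s w + h a b w) * (s w - h a b w) ≠ 0 := by
    rw [add_h_mul_sub_h hs₀]
    exact mul_ne_zero (by simp) hg
  obtain ⟨hadd, hsub⟩ := mul_ne_zero_iff.1 hprod
  have hAs : A a b w + s w ≠ 0 := by
    intro hA
    rw [hA, norm_zero, norm_eq_zero] at heq
    exact hs₀' (by linear_combination hA / 2 - heq / 2)
  have hAs' : A a b w - s w ≠ 0 := by rwa [← norm_ne_zero_iff, heq, norm_ne_zero_iff]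
  have hconst := not_eventually_div_eq_const ha (div_ne_zero hAs' hAs) hsq
    (((analyticAt_A w).add hs).continuousAt.eventually_ne hAs)
  refine (isLimitOfZeros_iff ha).2 fun V hV ↦ ?_
  filter_upwards [eventually_exists_mul_pow_add_mul_pow_eq_zero_of_norm_eq
    (hs.add (analyticAt_h w)) (hs.sub (analyticAt_h w)) ((analyticAt_A w).add hs)
    ((analyticAt_A w).sub hs) heq hAs hadd hsub hconst
    (inter_mem hV (hs.continuousAt.eventually_ne hs₀'))] with n
  rintro ⟨z, ⟨hzV, hsz⟩, hz⟩
  exact ⟨z, hzV, (isRoot_W_iff (hsq z) hsz n).2 hz⟩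

/-! ### The equimodular locus -/

/-- The points at which the two characteristic roots have the same modulus. -/
def equimodularLocus (a b c d : ℝ) : Set ℂ :=
  {z | ‖lamPlus a b c d z‖ = ‖lamMinus a b c d z‖}

theorem norm_lamPlus (z : ℂ) :
    ‖lamPlus a b c d z‖ = ‖A a b z + Complex.sqrt (Delta a b c d z)‖ / 2 := by
  simp [lamPlus]

theorem norm_lamMinus (z : ℂ) :
    ‖lamMinus a b c d z‖ = ‖A a b z - Complex.sqrt (Delta a b c d z)‖ / 2 := by
  simp [lamMinus]

theorem mem_equimodularLocus_iff_norm {z : ℂ} : z ∈ equimodularLocus a b c d ↔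
    ‖A a b z - Complex.sqrt (Delta a b c d z)‖ = ‖A a b z + Complex.sqrt (Delta a b c d z)‖ := by
  rw [equimodularLocus, Set.mem_ofPred_eq, norm_lamPlus, norm_lamMinus,
    div_left_inj' two_ne_zero, eq_comm]

theorem mem_equimodularLocus_iff {z : ℂ} : z ∈ equimodularLocus a b c d ↔
    ∃ θ ∈ Set.Icc (0 : ℝ) 1, A a b z ^ 2 + 4 * θ * B c d z = 0 := by
  rw [mem_equimodularLocus_iff_norm, norm_sub_eq_norm_add_iff_zero_mem_segment, sqrt_sq,
    segment_eq_image']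
  refine exists_congr fun θ ↦ and_congr_right fun _ ↦ ?_
  simp only [Complex.real_smul, Delta, add_sub_cancel_left]
  rw [mul_left_comm, mul_assoc]

theorem frequently_mem_equimodularLocus_of_analyticAt (ha : a ≠ 0) {φ : ℂ → ℂ} {w : ℂ}
    (hφ : AnalyticAt ℂ φ w) (hφw : φ w ∈ ((↑) : ℝ → ℂ) '' Set.Icc 0 1)
    (hφAB : ∀ᶠ z in 𝓝 w, A a b z ^ 2 + 4 * φ z * B c d z = 0) :
    ∃ᶠ z in 𝓝[≠] w, z ∈ equimodularLocus a b c d := by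
  have hne : ¬ ∀ᶠ z in 𝓝 w, φ z = φ w := by
    intro hconst
    obtain ⟨z, ⟨hz, hAB⟩, hAB'⟩ := (((hconst.and hφAB).filter_mono nhdsWithin_le_nhds).and
      (eventually_A_sq_add_mul_B_ne_zero ha b c d (4 * φ w) w)).exists
    exact hAB' (hz ▸ hAB)
  refine ((frequently_nhdsNE_comp_of_analyticAt hφ hne (accPt_iff_frequently_nhdsNE.1
    (preperfect_ofReal_image_Icc _ hφw))).and_eventually
    (hφAB.filter_mono nhdsWithin_le_nhds)).mono ?_
  rintro z ⟨⟨θ, hθ, hz⟩, hAB⟩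
  exact mem_equimodularLocus_iff.2 ⟨θ, hθ, hz ▸ hAB⟩

theorem frequently_mem_equimodularLocus (ha : a ≠ 0) (hc : c ≠ 0) {w : ℂ}
    (hw : w ∈ equimodularLocus a b c d) : ∃ᶠ z in 𝓝[≠] w, z ∈ equimodularLocus a b c d := by
  obtain ⟨θ, hθ, hw⟩ := mem_equimodularLocus_iff.1 hw
  by_cases hB : B c d w = 0
  · have hA : A a b w = 0 := by simpa [hB] using hw
    have hc' : (c : ℂ) ≠ 0 := Complex.ofReal_ne_zero.2 hc
    refine frequently_mem_equimodularLocus_of_analyticAt ha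
      (φ := fun z ↦ -(a * A a b z) / (4 * c)) (analyticAt_const.mul (analyticAt_A w)).neg.div_const
      ⟨0, by simp [hA]⟩ (.of_forall fun z ↦ ?_)
    rw [A] at hA
    rw [B] at hB
    have hAB : a * B c d z = c * A a b z := by
      rw [A, B]
      linear_combination a * hB - c * hA
    field_simp
    linear_combination -A a b z * hAB
  · refine frequently_mem_equimodularLocus_of_analyticAt ha
      (φ := fun z ↦ -A a b z ^ 2 / (4 * B c d z))
      (((analyticAt_A w).pow 2).neg.div (analyticAt_const.mul (analyticAt_B w)) (by simp [hB]))
      ⟨θ, hθ, ?_⟩ ?_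
    · rw [eq_div_iff (by simp [hB])]
      linear_combination hw
    · filter_upwards [(analyticAt_B w).continuousAt.eventually_ne hB] with z hz
      field_simp
      ring

theorem nonIsolatedLimits_eq_equimodularLocus (ha : a ≠ 0) (hc : c ≠ 0)
    (hnd : ¬ (a = 1 ∧ b + c = 0 ∧ d = 0)) :
    nonIsolatedLimits a b c d = equimodularLocus a b c d := by
  refine Set.inter_eq_right.2 fun w hw ↦ ?_
  have hgeneric := (frequently_mem_equimodularLocus ha hc hw).and_eventually
    ((eventually_g_ne_zero hnd w).and (eventually_A_sq_add_mul_B_ne_zero ha b c d 4 w))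
  refine (isClosed_setOf_isLimitOfZeros ha).closure_subset
    (mem_closure_iff_frequently.2 ((hgeneric.filter_mono nhdsWithin_le_nhds).mono ?_))
  rintro z ⟨hz, hg, hΔ⟩
  refine isLimitOfZeros_of_norm_sub_eq_norm_add ha (sqrt_sq _) (fun h₀ ↦ hΔ ?_)
    (mem_equimodularLocus_iff_norm.1 hz) hg
  rw [← Delta, ← sqrt_sq (Delta a b c d z), h₀, zero_pow two_ne_zero]

theorem mem_isolatedLimits_iff {z : ℂ} : z ∈ isolatedLimits a b c d ↔
    IsLimitOfZeros a b c d z ∧ g a b c d z = 0 ∧ ‖A a b z + h a b z‖ < ‖A a b z - h a b z‖ := by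
  have hσ := sqrt_sq (Delta a b c d z)
  have hg : g a b c d z = 0 ↔ Complex.sqrt (Delta a b c d z) = h a b z ∨
      Complex.sqrt (Delta a b c d z) = -h a b z := by
    rw [← sq_eq_sq_iff_eq_or_eq_neg, ← sub_eq_zero (a := _ ^ 2), sq_sub_sq, add_h_mul_sub_h hσ]
    simp
  rw [isolatedLimits, Set.mem_ofPred_eq, norm_lamPlus, norm_lamMinus,
    div_lt_div_iff_of_pos_right two_pos, div_lt_div_iff_of_pos_right two_pos, hg, or_and_right,
    alphaPlus, alphaMinus]
  generalize Complex.sqrt (Delta a b c d z) = σ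
  have hσ0 (h₀ : ‖A a b z + σ‖ ≠ ‖A a b z - σ‖) : σ ≠ 0 := by
    rintro rfl
    simp at h₀
  refine and_congr_right fun _ ↦ or_congr ⟨fun ⟨hα, hlt⟩ ↦ ?_, ?_⟩ ⟨fun ⟨hα, hlt⟩ ↦ ?_, ?_⟩
  · have hσh : σ = h a b z := by simpa [hσ0 hlt.ne, sub_eq_zero] using hα
    exact ⟨hσh, hσh ▸ hlt⟩
  · rintro ⟨rfl, hlt⟩
    simpa using hlt
  · have hσh : σ = -h a b z := by simpa [hσ0 hlt.ne', add_eq_zero_iff_eq_neg] using hα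
    refine ⟨hσh, ?_⟩
    rwa [hσh, sub_neg_eq_add, ← sub_eq_add_neg] at hlt
  · rintro ⟨rfl, hlt⟩
    rw [sub_neg_eq_add, ← sub_eq_add_neg]
    simpa using hlt

theorem isolatedLimits_eq (ha : a ≠ 0) (hnd : ¬ (a = 1 ∧ b + c = 0 ∧ d = 0)) :
    isolatedLimits a b c d =
      {z : ℂ | g a b c d z = 0 ∧ (A a b z * (starRingEnd ℂ) (h a b z)).re < 0} := by
  ext z
  have hinner : ‖A a b z + h a b z‖ < ‖A a b z - h a b z‖ ↔
      (A a b z * (starRingEnd ℂ) (h a b z)).re < 0 := by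
    rw [norm_add_lt_norm_sub_iff_inner_neg, real_inner_comm, Complex.inner]
  rw [mem_isolatedLimits_iff, hinner, Set.mem_ofPred_eq]
  refine and_iff_right_of_imp fun ⟨hg, hlt⟩ ↦ ?_
  have hh : h a b z ^ 2 = Delta a b c d z := by
    have hg' : h a b z ^ 2 - Delta a b c d z = 4 * g a b c d z := by
      simp only [h, Delta, A, B, g]
      ring
    rwa [hg, mul_zero, sub_eq_zero] at hg'
  refine isLimitOfZeros_of_add_h_eq_zero ha hnd (s₀ := -h a b z) (by rwa [neg_sq]) ?_
    (neg_add_cancel _)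
  rw [sub_neg_eq_add, ← sub_eq_add_neg]
  exact hinner.2 hlt

theorem IsLimitOfZeros.isolated_or_nonIsolated {z : ℂ} (hz : IsLimitOfZeros a b c d z) :
    z ∈ isolatedLimits a b c d ∨ z ∈ nonIsolatedLimits a b c d := by
  have hσ := sqrt_sq (Delta a b c d z)
  rcases lt_trichotomy ‖lamPlus a b c d z‖ ‖lamMinus a b c d z‖ with hlt | heq | hgt
  · refine .inl ⟨hz, .inl ⟨?_, hlt⟩⟩
    rw [norm_lamPlus, norm_lamMinus, div_lt_div_iff_of_pos_right two_pos] at hlt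
    have hh := hz.add_h_eq_zero (s₀ := -Complex.sqrt (Delta a b c d z)) (by rw [neg_sq, hσ])
      (by rwa [sub_neg_eq_add, ← sub_eq_add_neg])
    simp [alphaMinus, ← neg_add_eq_zero.1 hh]
  · exact .inr ⟨hz, heq⟩
  · refine .inl ⟨hz, .inr ⟨?_, hgt⟩⟩
    rw [norm_lamPlus, norm_lamMinus, div_lt_div_iff_of_pos_right two_pos] at hgt
    simp [alphaPlus, hz.add_h_eq_zero hσ hgt]

/-! ### The shape of the equimodular locus -/

theorem A_eq (ha : a ≠ 0) (z : ℂ) : A a b z = a * (z - xA a b) := by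
  have ha' : (a : ℂ) ≠ 0 := mod_cast ha
  simp only [A, xA, Complex.ofReal_div, Complex.ofReal_neg]
  field_simp
  ring

theorem B_eq (a b : ℝ) (z : ℂ) : B c d z = c * (z - xA a b) + BxA a b c d := by
  simp only [B, BxA, Complex.ofReal_add, Complex.ofReal_mul]
  ring

theorem mem_equimodularLocus_iff_re_im (ha : a ≠ 0) {z : ℂ} : z ∈ equimodularLocus a b c d ↔
    ∃ θ ∈ Set.Icc (0 : ℝ) 1,
      a ^ 2 * ((z.re - xA a b) ^ 2 - z.im ^ 2) +
        4 * θ * (c * (z.re - xA a b) + BxA a b c d) = 0 ∧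
      z.im * (a ^ 2 * (z.re - xA a b) + 2 * θ * c) = 0 := by
  rw [mem_equimodularLocus_iff]
  refine exists_congr fun θ ↦ and_congr_right fun _ ↦ ?_
  have hre : ((a * (z - xA a b) : ℂ) ^ 2 + 4 * θ * (c * (z - xA a b) + BxA a b c d)).re =
      a ^ 2 * ((z.re - xA a b) ^ 2 - z.im ^ 2) +
        4 * θ * (c * (z.re - xA a b) + BxA a b c d) := by
    simp only [pow_two, Complex.add_re, Complex.mul_re, Complex.ofReal_re, Complex.sub_re,
      Complex.ofReal_im, Complex.sub_im, sub_zero, zero_mul, Complex.mul_im, add_zero,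
      Complex.re_ofNat, Complex.im_ofNat, mul_zero, Complex.add_im, add_left_inj]
    ring
  have him : ((a * (z - xA a b) : ℂ) ^ 2 + 4 * θ * (c * (z - xA a b) + BxA a b c d)).im =
      2 * (z.im * (a ^ 2 * (z.re - xA a b) + 2 * θ * c)) := by
    simp only [pow_two, Complex.add_im, Complex.mul_im, Complex.mul_re, Complex.ofReal_re,
      Complex.sub_re, Complex.ofReal_im, Complex.sub_im, sub_zero, zero_mul, add_zero,
      Complex.re_ofNat, Complex.im_ofNat, mul_zero, Complex.add_re]
    ring
  rw [A_eq ha, B_eq a b, Complex.ext_iff, hre, him, Complex.zero_re, Complex.zero_im,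
    mul_eq_zero_iff_left two_ne_zero]

theorem mem_C0_iff (hc : c ≠ 0) {z : ℂ} : z ∈ C0 a b c d ↔
    c * ((z.re - xA a b) ^ 2 + z.im ^ 2) + 2 * (z.re - xA a b) * BxA a b c d = 0 := by
  have hxB : c * xB c d = -d := by
    rw [xB]
    field_simp
  rw [C0, Set.mem_ofPred_eq, ← sq_eq_sq₀ (norm_nonneg _) (abs_nonneg _), sq_abs, Complex.sq_norm,
    Complex.normSq_apply, ← mul_right_inj' hc, BxA]
  simp only [Complex.sub_re, Complex.sub_im, Complex.ofReal_re, Complex.ofReal_im, sub_zero]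
  constructor <;> intro hz
  · linear_combination hz + 2 * (z.re - xA a b) * hxB
  · linear_combination hz - 2 * (z.re - xA a b) * hxB

theorem exists_mem_Icc_sq_add_mul_eq_zero_iff (ha : a ≠ 0) {x : ℝ} :
    (∃ θ ∈ Set.Icc (0 : ℝ) 1, a ^ 2 * x ^ 2 + 4 * θ * (c * x + BxA a b c d) = 0) ↔
      x = 0 ∨ (a ^ 2 * x + 2 * c) ^ 2 ≤ 4 * DeltaDelta a b c d := by
  have hsq : a ^ 2 * (a ^ 2 * x ^ 2 + 4 * (c * x + BxA a b c d)) =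
      (a ^ 2 * x + 2 * c) ^ 2 - 4 * DeltaDelta a b c d := by
    rw [DeltaDelta]
    ring
  have hle : a ^ 2 * x ^ 2 + 4 * (c * x + BxA a b c d) ≤ 0 ↔
      (a ^ 2 * x + 2 * c) ^ 2 ≤ 4 * DeltaDelta a b c d := by
    rw [← sub_nonpos (b := 4 * DeltaDelta a b c d), ← hsq, ← neg_nonneg, ← neg_nonneg (a := _ * _),
      ← mul_neg, mul_nonneg_iff_of_pos_left (by positivity)]
  simpa only [mul_left_comm _ (4 : ℝ), mul_assoc (4 : ℝ), hle, mul_eq_zero_iff_left,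
    pow_eq_zero_iff, ne_eq, ha, OfNat.ofNat_ne_zero, not_false_eq_true] using
    exists_mem_Icc_add_mul_eq_zero_iff (q := 4 * (c * x + BxA a b c d))
      (mul_nonneg (sq_nonneg a) (sq_nonneg x))

theorem mem_equimodularLocus_iff_mem_real_or_mem_C0 (ha : a ≠ 0) (hc : c ≠ 0) {z : ℂ} :
    z ∈ equimodularLocus a b c d ↔
      (z.im = 0 ∧ (z.re = xA a b ∨
        (a ^ 2 * (z.re - xA a b) + 2 * c) ^ 2 ≤ 4 * DeltaDelta a b c d)) ∨
      (z ∈ C0 a b c d ∧ c * (z.re - xA a b) ≤ 0 ∧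
        0 ≤ c * (a ^ 2 * (z.re - xA a b) + 2 * c)) := by
  rw [mem_equimodularLocus_iff_re_im ha, mem_C0_iff hc, ← sub_eq_zero (a := z.re)]
  generalize z.re - xA a b = x
  generalize z.im = y
  constructor
  · rintro ⟨θ, ⟨hθ₀, hθ₁⟩, hre, him⟩
    rcases mul_eq_zero.1 him with rfl | hx
    · refine .inl ⟨rfl, (exists_mem_Icc_sq_add_mul_eq_zero_iff ha).1 ⟨θ, ⟨hθ₀, hθ₁⟩, ?_⟩⟩
      linear_combination hre
    · have hcircle : a ^ 2 * (c * (x ^ 2 + y ^ 2) + 2 * x * BxA a b c d) = 0 := by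
        linear_combination -c * hre + 2 * (c * x + BxA a b c d) * hx
      have hcx : a ^ 2 * (c * x) = -(2 * θ * c ^ 2) := by linear_combination c * hx
      refine .inr ⟨(mul_eq_zero.1 hcircle).resolve_left (by positivity), ?_, ?_⟩
      · refine nonpos_of_mul_nonpos_right (hcx.trans_le ?_) (sq_pos_of_ne_zero ha)
        exact neg_nonpos.2 (by positivity)
      · linear_combination 2 * c ^ 2 * hθ₁ - hcx
  · rintro (⟨rfl, hx⟩ | ⟨hcircle, hx₀, hx₁⟩)
    · obtain ⟨θ, hθ, hre⟩ := (exists_mem_Icc_sq_add_mul_eq_zero_iff ha).2 hx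
      exact ⟨θ, hθ, by linear_combination hre, zero_mul _⟩
    · refine ⟨-(a ^ 2 * (c * x)) / (2 * c ^ 2), ⟨?_, ?_⟩, ?_, ?_⟩
      · exact div_nonneg (neg_nonneg.2 (mul_nonpos_of_nonneg_of_nonpos (by positivity) hx₀))
          (by positivity)
      · rw [div_le_one (by positivity)]
        linear_combination hx₁
      · field_simp
        linear_combination -2 * a ^ 2 * hcircle
      · field_simp
        ring

theorem mul_sub_nonpos_of_mem_C0 (hc : c ≠ 0) (hβ : 0 < BxA a b c d) {z : ℂ}
    (hz : z ∈ C0 a b c d) :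
    c * (z.re - xA a b) ≤ 0 ∧ -(2 * BxA a b c d) ≤ c * (z.re - xA a b) := by
  rw [mem_C0_iff hc] at hz
  generalize z.re - xA a b = x at hz ⊢
  generalize z.im = y at hz
  have hsq : (c * x) * (c * x + 2 * BxA a b c d) = -(c * y) ^ 2 := by linear_combination c * hz
  have hle : (c * x) * (c * x + 2 * BxA a b c d) ≤ 0 := hsq ▸ neg_nonpos.2 (sq_nonneg _)
  rcases mul_nonpos_iff.1 hle with ⟨h₁, h₂⟩ | ⟨h₁, h₂⟩
  · constructor <;> linarith
  · constructor <;> linarith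

theorem eq_xA_of_mem_C0 (hc : c ≠ 0) (hβ : BxA a b c d ≤ 0) {z : ℂ} (hz : z ∈ C0 a b c d)
    (hx : c * (z.re - xA a b) ≤ 0) : z = xA a b := by
  rw [mem_C0_iff hc] at hz
  have hle : c ^ 2 * ((z.re - xA a b) ^ 2 + z.im ^ 2) ≤ 0 := by
    rw [show c ^ 2 * ((z.re - xA a b) ^ 2 + z.im ^ 2) =
      -(2 * (BxA a b c d * (c * (z.re - xA a b)))) by linear_combination c * hz]
    linarith [mul_nonneg_of_nonpos_of_nonpos hβ hx]
  have hsum := nonpos_of_mul_nonpos_right hle (sq_pos_of_ne_zero hc)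
  obtain ⟨hre, him⟩ := (add_eq_zero_iff_of_nonneg (sq_nonneg _) (sq_nonneg _)).1
    (hsum.antisymm (by positivity))
  exact Complex.ext (sub_eq_zero.1 (pow_eq_zero_iff two_ne_zero |>.1 hre))
    (pow_eq_zero_iff two_ne_zero |>.1 him)

theorem xA_mem_C0 : (xA a b : ℂ) ∈ C0 a b c d := by
  rw [C0, Set.mem_ofPred_eq, ← Complex.ofReal_sub, Complex.norm_real, Real.norm_eq_abs]

theorem mul_xDeltaPlus_sub_xA (ha : a ≠ 0) :
    (a : ℂ) ^ 2 * (xDeltaPlus a b c d - xA a b) + 2 * c =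
      2 * Complex.sqrt (DeltaDelta a b c d) := by
  have ha' : (a : ℂ) ≠ 0 := mod_cast ha
  rw [xDeltaPlus]
  field_simp
  ring

theorem mul_xDeltaMinus_sub_xA (ha : a ≠ 0) :
    (a : ℂ) ^ 2 * (xDeltaMinus a b c d - xA a b) + 2 * c =
      -(2 * Complex.sqrt (DeltaDelta a b c d)) := by
  have ha' : (a : ℂ) ≠ 0 := mod_cast ha
  rw [xDeltaMinus]
  field_simp
  ring

theorem mul_sub_xA_re (z : ℂ) : ((a : ℂ) ^ 2 * (z - xA a b) + 2 * c).re =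
    a ^ 2 * (z.re - xA a b) + 2 * c := by
  simp [← Complex.ofReal_pow]

theorem mem_JDelta_iff (ha : a ≠ 0) (hD : 0 ≤ DeltaDelta a b c d) {z : ℂ} :
    z ∈ JDelta a b c d ↔
      z.im = 0 ∧ (a ^ 2 * (z.re - xA a b) + 2 * c) ^ 2 ≤ 4 * DeltaDelta a b c d := by
  have hplus : a ^ 2 * ((xDeltaPlus a b c d).re - xA a b) + 2 * c = 2 * √(DeltaDelta a b c d) := by
    rw [← mul_sub_xA_re, mul_xDeltaPlus_sub_xA ha]
    simp [Complex.re_sqrt_ofReal]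
  have hminus : a ^ 2 * ((xDeltaMinus a b c d).re - xA a b) + 2 * c =
      -(2 * √(DeltaDelta a b c d)) := by
    rw [← mul_sub_xA_re, mul_xDeltaMinus_sub_xA ha]
    simp [Complex.re_sqrt_ofReal]
  have hsqrt : (2 * √(DeltaDelta a b c d)) ^ 2 = 4 * DeltaDelta a b c d := by
    rw [mul_pow, Real.sq_sqrt hD]
    norm_num
  rw [← hsqrt, sq_le_sq, abs_of_nonneg (a := 2 * _) (by positivity), abs_le, ← hminus, ← hplus,
    add_le_add_iff_right, add_le_add_iff_right, mul_le_mul_iff_right₀ (by positivity),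
    mul_le_mul_iff_right₀ (by positivity), sub_le_sub_iff_right, sub_le_sub_iff_right]
  constructor
  · rintro ⟨x, rfl, hx⟩
    exact ⟨Complex.ofReal_im x, hx⟩
  · rintro ⟨him, hx⟩
    exact ⟨z.re, Complex.ext rfl him, hx⟩

theorem re_eq_and_mem_C0_of_sq_eq (ha : a ≠ 0) (hc : c ≠ 0) (hD : DeltaDelta a b c d < 0) {z : ℂ}
    (hz : ((a : ℂ) ^ 2 * (z - xA a b) + 2 * c) ^ 2 = 4 * DeltaDelta a b c d) :
    a ^ 2 * (z.re - xA a b) + 2 * c = 0 ∧ z ∈ C0 a b c d := by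
  obtain ⟨hre, him⟩ := re_eq_zero_and_im_sq_of_sq_eq_ofReal
    (w := a ^ 2 * (z - xA a b) + 2 * c) (r := 4 * DeltaDelta a b c d) (by linarith)
    (by simp [hz])
  have him' : ((a : ℂ) ^ 2 * (z - xA a b) + 2 * c).im = a ^ 2 * z.im := by
    simp [← Complex.ofReal_pow]
  rw [mul_sub_xA_re] at hre
  refine ⟨hre, (mem_C0_iff hc).2 ?_⟩
  rw [him', DeltaDelta] at him
  refine (mul_eq_zero.1 ?_).resolve_left (pow_ne_zero 4 ha)
  linear_combination c * him + (c * a ^ 2 * (z.re - xA a b) + 2 * a ^ 2 * BxA a b c d -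
    2 * c ^ 2) * hre

theorem xDeltaMinus_ne_xDeltaPlus (ha : a ≠ 0) (hD : DeltaDelta a b c d ≠ 0) :
    xDeltaMinus a b c d ≠ xDeltaPlus a b c d := by
  intro heq
  have hminus := mul_xDeltaMinus_sub_xA (b := b) (c := c) (d := d) ha
  rw [heq, mul_xDeltaPlus_sub_xA ha] at hminus
  have hsqrt : Complex.sqrt (DeltaDelta a b c d) = 0 := by linear_combination hminus / 4
  have hsq := sqrt_sq (DeltaDelta a b c d)
  rw [hsqrt, zero_pow two_ne_zero] at hsq
  exact hD (mod_cast hsq.symm)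

theorem mem_circularArc_iff (ha : a ≠ 0) (hc : c ≠ 0) (hD : DeltaDelta a b c d < 0) {z : ℂ} :
    z ∈ circularArc (xDeltaMinus a b c d) (xA a b) (xDeltaPlus a b c d) ↔
      z ∈ C0 a b c d ∧ 0 ≤ c * (a ^ 2 * (z.re - xA a b) + 2 * c) := by
  have hsq := sqrt_sq (DeltaDelta a b c d)
  obtain ⟨hplus_re, hplus_mem⟩ := re_eq_and_mem_C0_of_sq_eq (z := xDeltaPlus a b c d) ha hc hD
    (by rw [mul_xDeltaPlus_sub_xA ha]; linear_combination 4 * hsq)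
  obtain ⟨hminus_re, hminus_mem⟩ := re_eq_and_mem_C0_of_sq_eq (z := xDeltaMinus a b c d) ha hc hD
    (by rw [mul_xDeltaMinus_sub_xA ha]; linear_combination 4 * hsq)
  have hne := xDeltaMinus_ne_xDeltaPlus (b := b) ha hD.ne
  have hxA {w : ℂ} (hw : a ^ 2 * (w.re - xA a b) + 2 * c = 0) : w ≠ xA a b := by
    rintro rfl
    simp [hc] at hw
  have hre : (xDeltaMinus a b c d).re = (xDeltaPlus a b c d).re :=
    sub_left_injective (mul_left_cancel₀ (pow_ne_zero 2 ha)
      (add_right_cancel (hminus_re.trans hplus_re.symm)))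
  have hC0 (w : ℂ) : w ∈ C0 a b c d ↔
      w ∈ (⟨xB c d, |xA a b - xB c d|⟩ : EuclideanGeometry.Sphere ℂ) := by
    rw [EuclideanGeometry.mem_sphere, dist_eq_norm, C0, Set.mem_ofPred_eq]
  have hcircle := cospherical_insert_iff_mem_sphere (z := z) Complex.finrank_real_complex
    ((hC0 _).1 hminus_mem) ((hC0 _).1 xA_mem_C0) ((hC0 _).1 hplus_mem) (hxA hminus_re) hne
    (hxA hplus_re).symm
  refine and_congr (hcircle.trans (hC0 z).symm) ?_
  have hside : a ^ 4 * ((xA a b - (xDeltaMinus a b c d).re) * (z.re - (xDeltaMinus a b c d).re)) =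
      2 * (c * (a ^ 2 * (z.re - xA a b) + 2 * c)) := by
    linear_combination (-a ^ 2 * (z.re - (xDeltaMinus a b c d).re) - 2 * c) * hminus_re
  rw [wSameSide_affineSpan_pair_iff_of_re_eq hne hre, Complex.ofReal_re,
    ← mul_nonneg_iff_of_pos_left (c := a ^ 4) (by positivity), hside,
    mul_nonneg_iff_of_pos_left two_pos]

theorem BxA_pos_of_DeltaDelta_nonpos (hc : c ≠ 0) (hD : DeltaDelta a b c d ≤ 0) :
    0 < BxA a b c d := by
  refine pos_of_mul_pos_right ((by positivity : 0 < c ^ 2).trans_le ?_) (sq_nonneg a)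
  exact sub_nonpos.1 hD

theorem equimodularLocus_eq_circularArc (ha : a ≠ 0) (hc : c ≠ 0) (hD : DeltaDelta a b c d < 0) :
    equimodularLocus a b c d =
      circularArc (xDeltaMinus a b c d) (xA a b) (xDeltaPlus a b c d) := by
  ext z
  rw [mem_equimodularLocus_iff_mem_real_or_mem_C0 ha hc, mem_circularArc_iff ha hc hD]
  constructor
  · rintro (⟨him, hre | hle⟩ | ⟨hz, -, hside⟩)
    · rw [show z = xA a b from Complex.ext hre him]
      exact ⟨xA_mem_C0, by simpa [← pow_two, mul_left_comm c] using sq_nonneg c⟩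
    · linarith [sq_nonneg (a ^ 2 * (z.re - xA a b) + 2 * c)]
    · exact ⟨hz, hside⟩
  · rintro ⟨hz, hside⟩
    exact .inr ⟨hz, (mul_sub_nonpos_of_mem_C0 hc
      (BxA_pos_of_DeltaDelta_nonpos hc hD.le) hz).1, hside⟩

theorem equimodularLocus_eq_JDelta_union_C0 (ha : a ≠ 0) (hc : c ≠ 0)
    (hD : 0 ≤ DeltaDelta a b c d) (hβ : 0 < BxA a b c d) :
    equimodularLocus a b c d = JDelta a b c d ∪ C0 a b c d := by
  ext z
  rw [mem_equimodularLocus_iff_mem_real_or_mem_C0 ha hc, Set.mem_union, mem_JDelta_iff ha hD]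
  constructor
  · rintro (⟨him, hre | hle⟩ | ⟨hz, -, -⟩)
    · rw [show z = xA a b from Complex.ext hre him]
      exact .inr xA_mem_C0
    · exact .inl ⟨him, hle⟩
    · exact .inr hz
  · rintro (⟨him, hle⟩ | hz)
    · exact .inl ⟨him, .inr hle⟩
    · obtain ⟨hx, hx'⟩ := mul_sub_nonpos_of_mem_C0 hc hβ hz
      refine .inr ⟨hz, hx, ?_⟩
      rw [DeltaDelta] at hD
      linear_combination 2 * hD + a ^ 2 * hx'

theorem JDelta_subset_C0 (ha : a ≠ 0) (hc : c ≠ 0) (hD : DeltaDelta a b c d = 0) :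
    JDelta a b c d ⊆ C0 a b c d := by
  intro z hz
  obtain ⟨him, hle⟩ := (mem_JDelta_iff ha hD.ge).1 hz
  rw [hD, mul_zero] at hle
  have hre : a ^ 2 * (z.re - xA a b) + 2 * c = 0 :=
    pow_eq_zero_iff two_ne_zero |>.1 (hle.antisymm (sq_nonneg _))
  rw [mem_C0_iff hc, him]
  rw [DeltaDelta] at hD
  refine (mul_eq_zero.1 ?_).resolve_left (pow_ne_zero 2 ha)
  linear_combination c * (z.re - xA a b) * hre - 2 * (z.re - xA a b) * hD

theorem equimodularLocus_eq_C0 (ha : a ≠ 0) (hc : c ≠ 0) (hD : DeltaDelta a b c d = 0) :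
    equimodularLocus a b c d = C0 a b c d := by
  rw [equimodularLocus_eq_JDelta_union_C0 ha hc hD.ge
    (BxA_pos_of_DeltaDelta_nonpos hc hD.le), Set.union_eq_right]
  exact JDelta_subset_C0 ha hc hD

theorem equimodularLocus_eq_JDelta (ha : a ≠ 0) (hc : c ≠ 0) (hβ : BxA a b c d ≤ 0) :
    equimodularLocus a b c d = JDelta a b c d := by
  have hle : c ^ 2 ≤ DeltaDelta a b c d :=
    (le_sub_self_iff _).2 (mul_nonpos_of_nonneg_of_nonpos (sq_nonneg a) hβ)
  ext z
  rw [mem_equimodularLocus_iff_mem_real_or_mem_C0 ha hc,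
    mem_JDelta_iff ha ((sq_nonneg c).trans hle)]
  have hxA (hre : z.re = xA a b) :
      (a ^ 2 * (z.re - xA a b) + 2 * c) ^ 2 ≤ 4 * DeltaDelta a b c d := by
    rw [hre]
    linear_combination 4 * hle
  constructor
  · rintro (⟨him, hre | hz⟩ | ⟨hz, hx, -⟩)
    · exact ⟨him, hxA hre⟩
    · exact ⟨him, hz⟩
    · have hz' := eq_xA_of_mem_C0 hc hβ hz hx
      exact ⟨by simp [hz'], hxA (by simp [hz'])⟩
  · rintro ⟨him, hz⟩
    exact .inl ⟨him, .inr hz⟩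

end LinRec

theorem mainTheorem1 (a b c d : ℝ) (hac : a * c ≠ 0)
    (hnd : ¬ (a = 1 ∧ b + c = 0 ∧ d = 0)) :
    (∀ z : ℂ, LinRec.IsLimitOfZeros a b c d z →
      z ∈ LinRec.isolatedLimits a b c d ∨ z ∈ LinRec.nonIsolatedLimits a b c d) ∧
    LinRec.isolatedLimits a b c d =
      {z : ℂ | LinRec.g a b c d z = 0 ∧
        (LinRec.A a b z * (starRingEnd ℂ) (LinRec.h a b z)).re < 0} ∧
    (LinRec.DeltaDelta a b c d < 0 →
      LinRec.nonIsolatedLimits a b c d =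
        LinRec.circularArc (LinRec.xDeltaMinus a b c d) (LinRec.xA a b : ℂ)
          (LinRec.xDeltaPlus a b c d)) ∧
    (LinRec.DeltaDelta a b c d = 0 →
      LinRec.nonIsolatedLimits a b c d = LinRec.C0 a b c d) ∧
    (0 < LinRec.DeltaDelta a b c d → 0 < LinRec.BxA a b c d →
      LinRec.nonIsolatedLimits a b c d = LinRec.JDelta a b c d ∪ LinRec.C0 a b c d) ∧
    (0 < LinRec.DeltaDelta a b c d → LinRec.BxA a b c d ≤ 0 →
      LinRec.nonIsolatedLimits a b c d = LinRec.JDelta a b c d) := by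
  obtain ⟨ha, hc⟩ := mul_ne_zero_iff.1 hac
  have hlocus := LinRec.nonIsolatedLimits_eq_equimodularLocus ha hc hnd
  exact ⟨fun _ hz ↦ hz.isolated_or_nonIsolated, LinRec.isolatedLimits_eq ha hnd,
    fun hD ↦ hlocus.trans (LinRec.equimodularLocus_eq_circularArc ha hc hD),
    fun hD ↦ hlocus.trans (LinRec.equimodularLocus_eq_C0 ha hc hD),
    fun hD hβ ↦ hlocus.trans (LinRec.equimodularLocus_eq_JDelta_union_C0 ha hc hD.le hβ),
    fun _ hβ ↦ hlocus.trans (LinRec.equimodularLocus_eq_JDelta ha hc hβ)⟩
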